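/- Let $G$ be a finite group and let $T$ be a $G$-Tambara functor, given by commutative rings $T(G/H)$ for the subgroups $H\le G$, together with restrictions, transfers, norms and conjugations $c_g$ satisfying the usual axioms. A Tambara ideal $I$ of $T$ is a family of ideals $I(G/H)\subseteq T(G/H)$, $H\le G$, closed under restrictions, transfers and norms, and with $c_g(I(G/H))=I(G/gHg^{-1})$. Tambara ideals are ordered by (levelwise) inclusion; $\langle X\rangle$ is the smallest Tambara ideal containing a family $X$ of elements $x_\alpha\in T(G/H_\alpha)$, and an ideal is finitely generated if it is $\langle X\rangle$ for a finite family $X$. The product $IJ$ is the Tambara ideal generated by the levelwise products $I(G/H)\cdot J(G/H)$. The radical of $I$ is the Tambara ideal $\sqrt I$ with $$(\sqrt I)(G/H)=\{x\in T(G/H) : \langle x\rangle^n\subseteq I \text{ for some } n\ge 1\},$$ and $I$ is radical if $I=\sqrt I$. Let $\mathrm{RadId}_G(T)$ be the set of radical Tambara ideals of $T$, ordered by inclusion. **Theorem.** The ordered set $\mathrm{RadId}_G(T)$ is a coherent frame: it is a complete lattice in which finite meets distribute over arbitrary joins, each element is a join of compact elements, the meet of two compact elements is compact, and the top element is compact.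 The compact elements of $\mathrm{RadId}_G(T)$ are exactly the ideals $\sqrt{J}$ with $J$ a finitely generated Tambara ideal of $T$. -/

import Mathlib

open scoped Pointwise

/-! ### Representatives of double cosets and of orbits, in a group `G`.
`MulAut.conj g • H` is the conjugate subgroup `g H g⁻¹`. -/

section Representatives

variable {G : Type*} [Group G]

/-- `R` is a complete irredundant set of representatives, all of them in `S`, for the double cosets
`L γ H` that make up `S` (a union of such double cosets, for instance a subgroup containing `L`
and `H`). -/
def IsDoubleCosetReps (L H : Subgroup G) (S : Set G) (R : Finset G) : Prop :=
  (R : Set G) ⊆ S ∧ ∀ x ∈ S, ∃! γ, γ ∈ R ∧ x ∈ DoubleCoset.doubleCoset γ (L : Set G) (H : Set G)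

/-- `R` is a complete irredundant set of representatives for the orbits of `K`, acting by left
translation, on the collection `X` of subsets of `G`. -/
def IsOrbitReps (K : Subgroup G) (X : Set (Set G)) (R : Finset (Set G)) : Prop :=
  (R : Set (Set G)) ⊆ X ∧ ∀ S ∈ X, ∃! S', S' ∈ R ∧ ∃ k ∈ K, k • S' = S

/-- The stabilizer in `K` of a subset `S` of `G` under left translation. -/
def translationStabilizer (K : Subgroup G) (S : Set G) : Subgroup G :=
  K ⊓ MulAction.stabilizer G S

/-- The subsets of `K` that are unions of left cosets of `H`. Those are the functions from `K / H`
to a set of two elements, with the left translation action of `K`. -/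
def cosetUnions (H K : Subgroup G) : Set (Set G) :=
  {S | S ⊆ (K : Set G) ∧ ∀ x ∈ S, ∀ h ∈ H, x * h ∈ S}

/-- For `J ≤ H ≤ K`, the subsets of `K` that meet each left coset of `H` in `K` in exactly one
left coset of `J`. Those are the (images of) sections of the projection `K / J → K / H`, with the
left translation action of `K`. -/
def cosetSections (J H K : Subgroup G) : Set (Set G) :=
  {S | S ⊆ (K : Set G) ∧ ∀ k ∈ K, ∃ δ : G, S ∩ (k • (H : Set G)) = δ • (J : Set G)}

end Representatives

universe u v

/-- The rings and operations of a `G`-Tambara functor: `obj H` is the value at `G / H`, and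
`res`, `tr`, `nm`, `conj` are restriction, transfer, norm and conjugation. The target of the
conjugation by `g` is `obj H'` where `H' = g H g⁻¹`. -/
structure TambaraData (G : Type v) [Group G] where
  obj : Subgroup G → Type u
  [commRing : ∀ H, CommRing (obj H)]
  res : ∀ {K H : Subgroup G}, K ≤ H → (obj H →+* obj K)
  tr : ∀ {K H : Subgroup G}, K ≤ H → (obj K →+ obj H)
  nm : ∀ {K H : Subgroup G}, K ≤ H → (obj K →* obj H)
  conj : ∀ (g : G) {H H' : Subgroup G}, H' = MulAut.conj g • H → (obj H ≃+* obj H')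

attribute [instance] TambaraData.commRing

namespace TambaraData

variable {G : Type v} [Group G] (T : TambaraData.{u} G)

/-- `res^{γ H γ⁻¹}_{L ∩ γ H γ⁻¹} (c_γ x)`. -/
def conjRes (L : Subgroup G) (γ : G) {H : Subgroup G} (x : T.obj H) :
    T.obj (L ⊓ MulAut.conj γ • H) :=
  T.res inf_le_right (T.conj γ rfl x)

/-- `tr^L_{L ∩ γ H γ⁻¹} (res^{γ H γ⁻¹}_{L ∩ γ H γ⁻¹} (c_γ x))`. -/
def trConjRes (L : Subgroup G) (γ : G) {H : Subgroup G} (x : T.obj H) : T.obj L :=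
  T.tr inf_le_left (T.conjRes L γ x)

/-- `N^L_{L ∩ γ H γ⁻¹} (res^{γ H γ⁻¹}_{L ∩ γ H γ⁻¹} (c_γ x))`. -/
def nmConjRes (L : Subgroup G) (γ : G) {H : Subgroup G} (x : T.obj H) : T.obj L :=
  T.nm inf_le_left (T.conjRes L γ x)

end TambaraData

open scoped Classical in
/-- A `G`-Tambara functor for a finite group `G`. Sums over double cosets and over orbits are
written with an arbitrary set of representatives. -/
structure TambaraFunctor (G : Type v) [Group G] [Finite G] extends TambaraData.{u} G where
  -- functoriality
  res_self : ∀ {H : Subgroup G} (h : H ≤ H) (x : obj H), res h x = x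
  tr_self : ∀ {H : Subgroup G} (h : H ≤ H) (x : obj H), tr h x = x
  nm_self : ∀ {H : Subgroup G} (h : H ≤ H) (x : obj H), nm h x = x
  conj_self : ∀ {H : Subgroup G} {h : G}, h ∈ H → ∀ (e : H = MulAut.conj h • H) (x : obj H),
    conj h e x = x
  res_res : ∀ {L K H : Subgroup G} (hLK : L ≤ K) (hKH : K ≤ H) (x : obj H),
    res hLK (res hKH x) = res (hLK.trans hKH) x
  tr_tr : ∀ {L K H : Subgroup G} (hLK : L ≤ K) (hKH : K ≤ H) (x : obj L),
    tr hKH (tr hLK x) = tr (hLK.trans hKH) x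
  nm_nm : ∀ {L K H : Subgroup G} (hLK : L ≤ K) (hKH : K ≤ H) (x : obj L),
    nm hKH (nm hLK x) = nm (hLK.trans hKH) x
  conj_conj : ∀ (g h : G) {H H' H'' : Subgroup G} (e : H' = MulAut.conj h • H)
    (e' : H'' = MulAut.conj g • H') (e'' : H'' = MulAut.conj (g * h) • H) (x : obj H),
    conj g e' (conj h e x) = conj (g * h) e'' x
  -- compatibility with conjugation
  conj_res : ∀ (g : G) {K H K' H' : Subgroup G} (hKH : K ≤ H) (hKH' : K' ≤ H')
    (eK : K' = MulAut.conj g • K) (eH : H' = MulAut.conj g • H) (x : obj H),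
    conj g eK (res hKH x) = res hKH' (conj g eH x)
  conj_tr : ∀ (g : G) {K H K' H' : Subgroup G} (hKH : K ≤ H) (hKH' : K' ≤ H')
    (eK : K' = MulAut.conj g • K) (eH : H' = MulAut.conj g • H) (x : obj K),
    conj g eH (tr hKH x) = tr hKH' (conj g eK x)
  conj_nm : ∀ (g : G) {K H K' H' : Subgroup G} (hKH : K ≤ H) (hKH' : K' ≤ H')
    (eK : K' = MulAut.conj g • K) (eH : H' = MulAut.conj g • H) (x : obj K),
    conj g eH (nm hKH x) = nm hKH' (conj g eK x)
  -- additive and multiplicative double coset formulas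
  res_tr : ∀ {L H K : Subgroup G} (hLK : L ≤ K) (hHK : H ≤ K) (R : Finset G),
    IsDoubleCosetReps L H (K : Set G) R → ∀ x : obj H,
      res hLK (tr hHK x) = ∑ γ ∈ R, toTambaraData.trConjRes L γ x
  res_nm : ∀ {L H K : Subgroup G} (hLK : L ≤ K) (hHK : H ≤ K) (R : Finset G),
    IsDoubleCosetReps L H (K : Set G) R → ∀ x : obj H,
      res hLK (nm hHK x) = ∏ γ ∈ R, toTambaraData.nmConjRes L γ x
  -- Frobenius reciprocity
  tr_res_mul : ∀ {K H : Subgroup G} (h : K ≤ H) (x : obj H) (y : obj K),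
    tr h (res h x * y) = x * tr h y
  /-- Tambara reciprocity for sums. The sum is over the orbits of `K` on the functions from
  `K / H` to `{a, b}`, the function given by `S` having the value `a` at `γ H` if `γ ∈ S`, and
  the product is over the orbits on `K / H` of the stabilizer of that function. -/
  nm_add : ∀ {H K : Subgroup G} (h : H ≤ K) (R : Finset (Set G)) (D : Set G → Finset G),
    IsOrbitReps K (cosetUnions H K) R →
    (∀ S ∈ R, IsDoubleCosetReps (translationStabilizer K S) H (K : Set G) (D S)) →
    ∀ a b : obj H,
      nm h (a + b) =
        ∑ S ∈ R, tr (inf_le_left : translationStabilizer K S ≤ K)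
          (∏ γ ∈ D S, toTambaraData.nmConjRes (translationStabilizer K S) γ
            (if γ ∈ S then a else b))
  /-- Tambara reciprocity for transfers. The sum is over the orbits of `K` on the sections of
  `K / J → K / H`, and the product is over the orbits on the image of the section (equivalently,
  on `K / H`) of the stabilizer of that section. -/
  nm_tr : ∀ {J H K : Subgroup G} (hJH : J ≤ H) (hHK : H ≤ K) (R : Finset (Set G))
    (D : Set G → Finset G),
    IsOrbitReps K (cosetSections J H K) R →
    (∀ S ∈ R, IsDoubleCosetReps (translationStabilizer K S) J S (D S)) →
    ∀ a : obj J,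
      nm hHK (tr hJH a) =
        ∑ S ∈ R, tr (inf_le_left : translationStabilizer K S ≤ K)
          (∏ γ ∈ D S, toTambaraData.nmConjRes (translationStabilizer K S) γ a)

section Ideals

variable {G : Type v} [Group G] [Finite G]

/-- A Tambara ideal: an ideal of `T(G/H)` for each `H`, closed under restrictions, transfers and
norms, and with `c_g (I(G/H)) = I(G/gHg⁻¹)`. -/
@[ext]
structure TambaraIdeal (T : TambaraFunctor.{u} G) where
  carrier : ∀ H : Subgroup G, Ideal (T.obj H)
  res_mem : ∀ {K H : Subgroup G} (h : K ≤ H) {x : T.obj H}, x ∈ carrier H → T.res h x ∈ carrier K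
  tr_mem : ∀ {K H : Subgroup G} (h : K ≤ H) {x : T.obj K}, x ∈ carrier K → T.tr h x ∈ carrier H
  nm_mem : ∀ {K H : Subgroup G} (h : K ≤ H) {x : T.obj K}, x ∈ carrier K → T.nm h x ∈ carrier H
  conj_image : ∀ (g : G) {H H' : Subgroup G} (e : H' = MulAut.conj g • H),
    T.conj g e '' (carrier H : Set (T.obj H)) = (carrier H' : Set (T.obj H'))

variable {T : TambaraFunctor.{u} G}

namespace TambaraIdeal

theorem conj_mem (I : TambaraIdeal T) (g : G) {H H' : Subgroup G} (e : H' = MulAut.conj g • H)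
    {x : T.obj H} (hx : x ∈ I.carrier H) : T.conj g e x ∈ I.carrier H' := by
  have : T.conj g e x ∈ (I.carrier H' : Set (T.obj H')) := by
    rw [← I.conj_image g e]; exact ⟨x, hx, rfl⟩
  exact this

/-- Closure under all conjugations, as inclusions, gives the equalities. -/
theorem conj_image_of_forall (C : ∀ H : Subgroup G, Ideal (T.obj H))
    (hC : ∀ (g : G) {H H' : Subgroup G} (e : H' = MulAut.conj g • H) {x : T.obj H},
      x ∈ C H → T.conj g e x ∈ C H')
    (g : G) {H H' : Subgroup G} (e : H' = MulAut.conj g • H) :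
    T.conj g e '' (C H : Set (T.obj H)) = (C H' : Set (T.obj H')) := by
  apply Set.Subset.antisymm
  · rintro _ ⟨x, hx, rfl⟩
    exact hC g e hx
  · intro y hy
    have e' : H = MulAut.conj g⁻¹ • H' := by rw [e, map_inv, inv_smul_smul]
    refine ⟨T.conj g⁻¹ e' y, hC _ e' hy, ?_⟩
    have e1 : H' = MulAut.conj (g * g⁻¹) • H' := by simp
    rw [T.conj_conj g g⁻¹ e' e e1 y]
    have h1 : (g * g⁻¹) ∈ H' := by simp
    exact T.conj_self h1 e1 y

instance : PartialOrder (TambaraIdeal T) :=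
  PartialOrder.lift TambaraIdeal.carrier (fun _ _ h => TambaraIdeal.ext h)

theorem le_def {I J : TambaraIdeal T} : I ≤ J ↔ ∀ H, I.carrier H ≤ J.carrier H := Iff.rfl

/-- Levelwise intersection. -/
instance : InfSet (TambaraIdeal T) where
  sInf F :=
    { carrier := fun H => ⨅ I ∈ F, I.carrier H
      res_mem := by
        intro K H h x hx
        simp only [Submodule.mem_iInf] at hx ⊢
        exact fun I hI => I.res_mem h (hx I hI)
      tr_mem := by
        intro K H h x hx
        simp only [Submodule.mem_iInf] at hx ⊢
        exact fun I hI => I.tr_mem h (hx I hI)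
      nm_mem := by
        intro K H h x hx
        simp only [Submodule.mem_iInf] at hx ⊢
        exact fun I hI => I.nm_mem h (hx I hI)
      conj_image := by
        apply conj_image_of_forall
        intro g H H' e x hx
        simp only [Submodule.mem_iInf] at hx ⊢
        exact fun I hI => I.conj_mem g e (hx I hI) }

theorem mem_sInf {F : Set (TambaraIdeal T)} {H : Subgroup G} {x : T.obj H} :
    x ∈ (sInf F).carrier H ↔ ∀ I ∈ F, x ∈ I.carrier H := by
  change x ∈ (⨅ I ∈ F, I.carrier H) ↔ _
  simp only [Submodule.mem_iInf]

instance : CompleteLattice (TambaraIdeal T) :=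
  completeLatticeOfInf _ fun _ =>
    ⟨fun _ hI _ _ hx => mem_sInf.1 hx _ hI, fun _ hJ _ _ hx => mem_sInf.2 fun _ hI => hJ hI _ hx⟩

/-- The Tambara ideal generated by a collection of elements `⟨H, x⟩`, `x ∈ T(G/H)`. -/
def span (X : Set (Σ H : Subgroup G, T.obj H)) : TambaraIdeal T :=
  sInf {I | ∀ p ∈ X, p.2 ∈ I.carrier p.1}

theorem span_le {X : Set (Σ H : Subgroup G, T.obj H)} {I : TambaraIdeal T} :
    span X ≤ I ↔ ∀ p ∈ X, p.2 ∈ I.carrier p.1 := by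
  constructor
  · intro h p hp
    exact h _ (mem_sInf.2 fun J hJ => hJ p hp)
  · exact fun h _ _ hx => mem_sInf.1 hx I h

/-- A Tambara ideal is finitely generated if it is generated by finitely many elements, of
arbitrary levels. -/
def FG (I : TambaraIdeal T) : Prop :=
  ∃ X : Set (Σ H : Subgroup G, T.obj H), X.Finite ∧ I = span X

/-- The Tambara ideal `⟨x⟩` generated by one element `x ∈ T(G/H)`. -/
def principal {H : Subgroup G} (x : T.obj H) : TambaraIdeal T := span {⟨H, x⟩}

theorem principal_le {H : Subgroup G} {x : T.obj H} {I : TambaraIdeal T} :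
    principal x ≤ I ↔ x ∈ I.carrier H := by
  simp [principal, span_le]

/-- The product of Tambara ideals: the Tambara ideal generated by the levelwise products. -/
instance : Mul (TambaraIdeal T) where
  mul I J := span {p | p.2 ∈ I.carrier p.1 * J.carrier p.1}

theorem mul_le {I J K : TambaraIdeal T} :
    I * J ≤ K ↔ ∀ H, I.carrier H * J.carrier H ≤ K.carrier H := by
  change span _ ≤ K ↔ _
  rw [span_le]
  exact ⟨fun h H x hx => h ⟨H, x⟩ hx, fun h p hp => h p.1 hp⟩

theorem le_mul (I J : TambaraIdeal T) (H : Subgroup G) :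
    I.carrier H * J.carrier H ≤ (I * J).carrier H := mul_le.1 le_rfl H

theorem mul_le_left (I J : TambaraIdeal T) : I * J ≤ I :=
  mul_le.2 fun _ => Ideal.mul_le_left

theorem mul_le_right (I J : TambaraIdeal T) : I * J ≤ J :=
  mul_le.2 fun _ => Ideal.mul_le_right

theorem mul_mono {I I' J J' : TambaraIdeal T} (h : I ≤ I') (h' : J ≤ J') : I * J ≤ I' * J' :=
  mul_le.2 fun H => (Ideal.mul_mono (h H) (h' H)).trans (le_mul I' J' H)

/-- The `n`-fold product `I * ⋯ * I` (with value `⊤` for `n = 0`). -/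
def power (I : TambaraIdeal T) : ℕ → TambaraIdeal T
  | 0 => ⊤
  | n + 1 => power I n * I

theorem power_mono {I J : TambaraIdeal T} (h : I ≤ J) : ∀ n, power I n ≤ power J n
  | 0 => le_rfl
  | n + 1 => mul_mono (power_mono h n) h

theorem power_succ_le (I : TambaraIdeal T) (n : ℕ) : power I (n + 1) ≤ power I n :=
  mul_le_left _ _

/-! The radical is closed under addition because levelwise sums of ideals are ideals. -/

theorem exists_reps {α : Type*} [Finite α] (r : α → α → Prop) (hr : Equivalence r)
    (X : Set α) : ∃ R : Finset α, (R : Set α) ⊆ X ∧ ∀ x ∈ X, ∃! y, y ∈ R ∧ r y x := by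
  classical
  let s : Setoid (X : Set α) := ⟨fun a b => r a b, fun a => hr.refl _, fun h => hr.symm h,
    fun h h' => hr.trans h h'⟩
  let f : Quotient s → α := fun q => (q.out : α)
  have hfin : (Set.range f).Finite := Set.toFinite _
  refine ⟨hfin.toFinset, ?_, ?_⟩
  · intro y hy
    obtain ⟨q, rfl⟩ := hfin.mem_toFinset.1 hy
    exact q.out.2
  · intro x hx
    refine ⟨f (Quotient.mk s ⟨x, hx⟩), ⟨hfin.mem_toFinset.2 ⟨_, rfl⟩, ?_⟩, ?_⟩
    · exact Quotient.mk_out (s := s) ⟨x, hx⟩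
    · rintro y ⟨hy, hyx⟩
      obtain ⟨q, rfl⟩ := hfin.mem_toFinset.1 hy
      congr 1
      rw [← q.out_eq]
      exact Quotient.sound hyx

theorem exists_isDoubleCosetReps (L H : Subgroup G) (S : Set G) :
    ∃ R, IsDoubleCosetReps L H S R := by
  obtain ⟨R, hR, hR'⟩ := exists_reps
    (fun y x => DoubleCoset.setoid (L : Set G) (H : Set G) y x)
    (DoubleCoset.setoid (L : Set G) (H : Set G)).iseqv S
  refine ⟨R, hR, fun x hx => ?_⟩
  have key : ∀ y, DoubleCoset.setoid (L : Set G) (H : Set G) y x ↔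
      x ∈ DoubleCoset.doubleCoset y (L : Set G) (H : Set G) := by
    intro y
    rw [DoubleCoset.rel_iff, DoubleCoset.mem_doubleCoset]
    exact ⟨fun ⟨a, ha, b, hb, h⟩ => ⟨a, ha, b, hb, h⟩, fun ⟨a, ha, b, hb, h⟩ => ⟨a, ha, b, hb, h⟩⟩
  simpa only [key] using hR' x hx

theorem exists_isOrbitReps (K : Subgroup G) (X : Set (Set G)) : ∃ R, IsOrbitReps K X R :=
  exists_reps (fun y x => ∃ k ∈ K, k • y = x)
    ⟨fun x => ⟨1, K.one_mem, one_smul _ _⟩,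
      by
        rintro x _ ⟨k, hk, rfl⟩
        exact ⟨k⁻¹, K.inv_mem hk, inv_smul_smul _ _⟩,
      by
        rintro x _ _ ⟨k, hk, rfl⟩ ⟨l, hl, rfl⟩
        exact ⟨l * k, K.mul_mem hl hk, mul_smul _ _ _⟩⟩ X

theorem nmConjRes_mem (I : TambaraIdeal T) (L : Subgroup G) (γ : G) {H : Subgroup G}
    {x : T.obj H} (hx : x ∈ I.carrier H) : T.nmConjRes L γ x ∈ I.carrier L :=
  I.nm_mem _ (I.res_mem _ (I.conj_mem _ _ hx))

/-- The levelwise sum of two Tambara ideals. -/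
def add (I J : TambaraIdeal T) : TambaraIdeal T where
  carrier H := I.carrier H ⊔ J.carrier H
  res_mem := by
    intro K H h x hx
    obtain ⟨a, ha, b, hb, rfl⟩ := Submodule.mem_sup.1 hx
    rw [map_add]
    exact Submodule.add_mem_sup (I.res_mem h ha) (J.res_mem h hb)
  tr_mem := by
    intro K H h x hx
    obtain ⟨a, ha, b, hb, rfl⟩ := Submodule.mem_sup.1 hx
    rw [map_add]
    exact Submodule.add_mem_sup (I.tr_mem h ha) (J.tr_mem h hb)
  nm_mem := by
    classical
    intro H K h x hx
    obtain ⟨a, ha, b, hb, rfl⟩ := Submodule.mem_sup.1 hx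
    obtain ⟨R, hR⟩ := exists_isOrbitReps K (cosetUnions H K)
    choose D hD using fun S : Set G =>
      exists_isDoubleCosetReps (translationStabilizer K S) H (K : Set G)
    rw [T.nm_add h R D hR (fun S _ => hD S) a b]
    refine Ideal.sum_mem _ fun S _ => ?_
    obtain ⟨γ, ⟨hγ, -⟩, -⟩ := (hD S).2 1 K.one_mem
    by_cases hS : γ ∈ S
    · refine Ideal.mem_sup_left (I.tr_mem _ (Ideal.prod_mem _ hγ ?_))
      rw [if_pos hS]
      exact I.nmConjRes_mem _ _ ha
    · refine Ideal.mem_sup_right (J.tr_mem _ (Ideal.prod_mem _ hγ ?_))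
      rw [if_neg hS]
      exact J.nmConjRes_mem _ _ hb
  conj_image := by
    apply conj_image_of_forall
    intro g H H' e x hx
    obtain ⟨a, ha, b, hb, rfl⟩ := Submodule.mem_sup.1 hx
    rw [map_add]
    exact Submodule.add_mem_sup (I.conj_mem g e ha) (J.conj_mem g e hb)

theorem sup_eq_add (I J : TambaraIdeal T) : I ⊔ J = add I J := by
  apply le_antisymm
  · exact sup_le (fun H => le_sup_left) (fun H => le_sup_right)
  · exact fun H => sup_le ((le_sup_left : I ≤ I ⊔ J) H) ((le_sup_right : J ≤ I ⊔ J) H)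

theorem mul_sup_le (I J K : TambaraIdeal T) : K * (I ⊔ J) ≤ K * I ⊔ K * J := by
  rw [sup_eq_add, sup_eq_add, mul_le]
  intro H
  change K.carrier H * (I.carrier H ⊔ J.carrier H) ≤ (K * I).carrier H ⊔ (K * J).carrier H
  rw [Ideal.mul_sup]
  exact sup_le_sup (le_mul K I H) (le_mul K J H)

theorem sup_mul_le (I J K : TambaraIdeal T) : (I ⊔ J) * K ≤ I * K ⊔ J * K := by
  rw [sup_eq_add, sup_eq_add, mul_le]
  intro H
  change (I.carrier H ⊔ J.carrier H) * K.carrier H ≤ (I * K).carrier H ⊔ (J * K).carrier H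
  rw [Ideal.sup_mul]
  exact sup_le_sup (le_mul I K H) (le_mul J K H)

theorem power_sup_le (I J : TambaraIdeal T) :
    ∀ N i j : ℕ, i + j = N → power (I ⊔ J) N ≤ power I i ⊔ power J j := by
  intro N
  induction N with
  | zero =>
    intro i j h
    obtain rfl : i = 0 := by omega
    exact le_sup_of_le_left le_top
  | succ N ih =>
    intro i j h
    rcases i with _ | i
    · exact le_sup_of_le_left le_top
    rcases j with _ | j
    · exact le_sup_of_le_right le_top
    refine (mul_sup_le I J (power (I ⊔ J) N)).trans (sup_le ?_ ?_)
    · refine (mul_mono (ih i (j + 1) (by omega)) le_rfl).trans ?_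
      exact (sup_mul_le _ _ _).trans (sup_le_sup le_rfl (mul_le_left _ _))
    · refine (mul_mono (ih (i + 1) j (by omega)) le_rfl).trans ?_
      exact (sup_mul_le _ _ _).trans (sup_le_sup (mul_le_left _ _) le_rfl)

/-- The radical of a Tambara ideal: at level `G / H` it consists of those `x` for which
`⟨x⟩ ^ n ⊆ I` for some `n ≥ 1`. -/
def radical (I : TambaraIdeal T) : TambaraIdeal T where
  carrier H :=
    { carrier := {x | ∃ n : ℕ, 1 ≤ n ∧ power (principal x) n ≤ I}
      zero_mem' :=
        ⟨1, le_rfl, (mul_le_right _ _).trans (principal_le.2 (I.carrier H).zero_mem)⟩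
      add_mem' := by
        rintro x y ⟨m, hm, hx⟩ ⟨n, hn, hy⟩
        refine ⟨m + n, by omega, ?_⟩
        have hxy : principal (x + y) ≤ principal x ⊔ principal y :=
          principal_le.2 (Ideal.add_mem _
            (principal_le.1 (le_sup_left : principal x ≤ principal x ⊔ principal y))
            (principal_le.1 (le_sup_right : principal y ≤ principal x ⊔ principal y)))
        exact (power_mono hxy _).trans
          ((power_sup_le _ _ _ m n rfl).trans (sup_le hx hy))
      smul_mem' := by
        rintro c x ⟨n, hn, hx⟩
        exact ⟨n, hn, (power_mono (principal_le.2
          (Ideal.mul_mem_left _ c (principal_le.1 le_rfl))) n).trans hx⟩ }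
  res_mem := by
    rintro K H h x ⟨n, hn, hx⟩
    exact ⟨n, hn, (power_mono (principal_le.2
      (res_mem _ h (principal_le.1 le_rfl))) n).trans hx⟩
  tr_mem := by
    rintro K H h x ⟨n, hn, hx⟩
    exact ⟨n, hn, (power_mono (principal_le.2
      (tr_mem _ h (principal_le.1 le_rfl))) n).trans hx⟩
  nm_mem := by
    rintro K H h x ⟨n, hn, hx⟩
    exact ⟨n, hn, (power_mono (principal_le.2
      (nm_mem _ h (principal_le.1 le_rfl))) n).trans hx⟩
  conj_image := by
    apply conj_image_of_forall
    rintro g H H' e x ⟨n, hn, hx⟩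
    exact ⟨n, hn, (power_mono (principal_le.2
      (conj_mem _ g e (principal_le.1 le_rfl))) n).trans hx⟩

end TambaraIdeal

variable (T) in
/-- The radical Tambara ideals of `T`, ordered by inclusion. -/
abbrev RadId : Type (max u v) := {I : TambaraIdeal T // I = I.radical}

variable (T) in
/-- The radicals of finitely generated Tambara ideals of `T`. -/
def RadFg : Set (TambaraIdeal T) := {I | ∃ J : TambaraIdeal T, J.FG ∧ I = J.radical}

end Ideals

/-- A frame is coherent if each element is a join of compact elements, the compact elements are
closed under binary meets, and the top element is compact. -/
structure IsCoherentFrame (A : Type*) [Order.Frame A] : Prop where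
  eq_sSup_compact : ∀ a : A, ∃ S : Set A, (∀ b ∈ S, IsCompactElement b) ∧ a = sSup S
  compact_inf : ∀ a b : A, IsCompactElement a → IsCompactElement b → IsCompactElement (a ⊓ b)
  compact_top : IsCompactElement (⊤ : A)

/-! The difficulty is that products and joins of Tambara ideals are defined by generation, so their
elements need an explicit form. The remedy is to forget addition and transfers: a multiplicative
ideal `S` is closed under multiples, restrictions, norms and conjugations only. By Frobenius
reciprocity, the double coset formula and Tambara reciprocity, the sums of transfers of elements of
`S` already form a Tambara ideal (`toTambaraIdeal`). Hence a product of ideals generated by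
multiplicative ideals can be tested on products of generators (`levelSpan_mul_levelSpan_le`), which
makes the product commutative, associative and distributive over joins.

The multiples of norms of restrictions of conjugates of a finite set form, once zero is included, a
multiplicative ideal. As `G` is finite, products of finitely generated ideals are therefore finitely
generated (`FG.mul`).

For radicals, √(IJ) = √I ⊓ √J turns meets into products, and distributivity of products gives the
frame law. A directed union of Tambara ideals is a Tambara ideal, and a finitely generated J ⊆ √I
has a power, again finitely generated, inside I. So √J is compact; conversely each radical ideal is
a directed join of such √J, so a compact one equals one of them. -/

namespace IsDoubleCosetReps

variable {G : Type v} [Group G] {L H : Subgroup G} {S : Set G} {R : Finset G}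

theorem nonempty (hR : IsDoubleCosetReps L H S R) (hS : S.Nonempty) : R.Nonempty := by
  obtain ⟨x, hx⟩ := hS
  obtain ⟨γ, ⟨hγ, -⟩, -⟩ := hR.2 x hx
  exact ⟨γ, hγ⟩

theorem mem (hR : IsDoubleCosetReps L H S R) {γ : G} (hγ : γ ∈ R) : γ ∈ S :=
  hR.1 (Finset.mem_coe.2 hγ)

end IsDoubleCosetReps

theorem Subgroup.le_conj_mul_smul {G : Type v} [Group G] {H L : Subgroup G} {δ γ : G} (hL : L ≤ MulAut.conj γ • H) :
    MulAut.conj δ • L ≤ MulAut.conj (δ * γ) • H := by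
  rw [map_mul, mul_smul]
  exact Subgroup.pointwise_smul_le_pointwise_smul_iff.2 hL

namespace TambaraFunctor

variable {G : Type v} [Group G] [Finite G] {T : TambaraFunctor.{u} G}

theorem conj_res_conj {H H' L L' : Subgroup G} (δ γ : G) (e : H' = MulAut.conj γ • H)
    (hL : L ≤ H') (e' : L' = MulAut.conj δ • L) (hL' : L' ≤ MulAut.conj (δ * γ) • H)
    (x : T.obj H) :
    T.conj δ e' (T.res hL (T.conj γ e x)) = T.res hL' (T.conj (δ * γ) rfl x) := by
  have h : MulAut.conj (δ * γ) • H = MulAut.conj δ • H' := by rw [e, map_mul, mul_smul]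
  rw [T.conj_res δ hL (H' := MulAut.conj (δ * γ) • H) hL' e' h, T.conj_conj δ γ e h rfl]

/-- Conjugation by an element of `K` is trivial at level `G / K` and commutes with norms. This
treats the terms of Tambara reciprocity whose stabilizer is all of `K`. -/
theorem nmConjRes_of_eq {H K K' : Subgroup G} (hHK : H ≤ K) (hK : K' = K) {γ : G} (hγ : γ ∈ K)
    (x : T.obj H) : T.nmConjRes K' γ x = T.res hK.le (T.nm hHK x) := by
  subst hK
  have hK' : K' = MulAut.conj γ • K' := (Subgroup.conj_smul_eq_self_of_mem hγ).symm
  have hle : MulAut.conj γ • H ≤ K' := by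
    rw [hK']
    exact Subgroup.pointwise_smul_le_pointwise_smul_iff.2 hHK
  have e : K' ⊓ MulAut.conj γ • H = MulAut.conj γ • H := inf_eq_right.2 hle
  have h1 : T.conjRes K' γ x = T.conj γ e x := by
    have := T.conj_res γ le_rfl (inf_le_right : K' ⊓ MulAut.conj γ • H ≤ _) e rfl x
    rw [T.res_self] at this
    exact this.symm
  rw [T.res_self]
  change T.nm inf_le_left (T.conjRes K' γ x) = _
  rw [h1, ← T.conj_nm γ hHK _ e hK', T.conj_self hγ]

end TambaraFunctor

/-! ### Multiplicative ideals and their sums of transfers -/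

section MultiplicativeIdeals

variable {G : Type v} [Group G] [Finite G]

/-- A collection of elements closed under all the operations of a Tambara functor except the
addition and the transfers: at each level it is closed under multiplication by arbitrary
elements, and it is closed under restrictions, norms and conjugations. -/
structure IsMultiplicativeIdeal (T : TambaraFunctor.{u} G) (S : ∀ H : Subgroup G, Set (T.obj H)) :
    Prop where
  zero_mem : ∀ H, (0 : T.obj H) ∈ S H
  mul_mem : ∀ {H : Subgroup G} (c : T.obj H) {x : T.obj H}, x ∈ S H → c * x ∈ S H
  res_mem : ∀ {K H : Subgroup G} (h : K ≤ H) {x : T.obj H}, x ∈ S H → T.res h x ∈ S K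
  nm_mem : ∀ {K H : Subgroup G} (h : K ≤ H) {x : T.obj K}, x ∈ S K → T.nm h x ∈ S H
  conj_mem : ∀ (g : G) {H H' : Subgroup G} (e : H' = MulAut.conj g • H) {x : T.obj H},
    x ∈ S H → T.conj g e x ∈ S H'

variable {T : TambaraFunctor.{u} G}

theorem TambaraIdeal.isMultiplicativeIdeal (I : TambaraIdeal T) :
    IsMultiplicativeIdeal T fun H => (I.carrier H : Set (T.obj H)) where
  zero_mem H := (I.carrier H).zero_mem
  mul_mem c _ hx := Ideal.mul_mem_left _ c hx
  res_mem h _ hx := I.res_mem h hx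
  nm_mem h _ hx := I.nm_mem h hx
  conj_mem g _ _ e _ hx := I.conj_mem g e hx

namespace IsMultiplicativeIdeal

variable {S S' : ∀ H : Subgroup G, Set (T.obj H)}

theorem conjRes_mem (hS : IsMultiplicativeIdeal T S) (L : Subgroup G) (γ : G) {H : Subgroup G}
    {x : T.obj H} (hx : x ∈ S H) : T.conjRes L γ x ∈ S (L ⊓ MulAut.conj γ • H) :=
  hS.res_mem _ (hS.conj_mem γ rfl hx)

theorem nmConjRes_mem (hS : IsMultiplicativeIdeal T S) (L : Subgroup G) (γ : G) {H : Subgroup G}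
    {x : T.obj H} (hx : x ∈ S H) : T.nmConjRes L γ x ∈ S L :=
  hS.nm_mem _ (hS.conjRes_mem L γ hx)

theorem prod_mem (hS : IsMultiplicativeIdeal T S) {H : Subgroup G} {ι : Type*} {R : Finset ι}
    {f : ι → T.obj H} {i : ι} (hi : i ∈ R) (hf : f i ∈ S H) : ∏ j ∈ R, f j ∈ S H := by
  classical
  rw [← Finset.prod_erase_mul R f hi]
  exact hS.mul_mem _ hf

/-- The sums of transfers of elements of `S`. -/
def trSums (S : ∀ H : Subgroup G, Set (T.obj H)) (H : Subgroup G) : AddSubmonoid (T.obj H) :=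
  AddSubmonoid.closure {y | ∃ (K : Subgroup G) (h : K ≤ H), ∃ x ∈ S K, y = T.tr h x}

theorem tr_mem_trSums {K H : Subgroup G} (h : K ≤ H) {x : T.obj K} (hx : x ∈ S K) :
    T.tr h x ∈ trSums S H :=
  AddSubmonoid.subset_closure ⟨K, h, x, hx, rfl⟩

theorem mem_trSums {H : Subgroup G} {x : T.obj H} (hx : x ∈ S H) : x ∈ trSums S H := by
  rw [← T.tr_self le_rfl x]
  exact tr_mem_trSums _ hx

/-- An additive map sends sums of transfers into `A` if it sends each transfer into `A`. -/
theorem map_mem_of_mem_trSums {H : Subgroup G} {M : Type*} [AddZeroClass M] (f : T.obj H →+ M)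
    {A : AddSubmonoid M} (hf : ∀ {K : Subgroup G} (h : K ≤ H) (x : T.obj K), x ∈ S K →
      f (T.tr h x) ∈ A) {y : T.obj H} (hy : y ∈ trSums S H) : f y ∈ A := by
  have h : trSums S H ≤ A.comap f :=
    AddSubmonoid.closure_le.2 (by rintro _ ⟨K, h, x, hx, rfl⟩; exact hf h x hx)
  exact h hy

theorem tr_trSums_mem {K H : Subgroup G} (h : K ≤ H) {y : T.obj K} (hy : y ∈ trSums S K) :
    T.tr h y ∈ trSums S H :=
  map_mem_of_mem_trSums (T.tr h) (fun hL x hx => by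
    rw [T.tr_tr]; exact tr_mem_trSums _ hx) hy

theorem mul_trSums_mem (hS : IsMultiplicativeIdeal T S) {H : Subgroup G} (c : T.obj H)
    {y : T.obj H} (hy : y ∈ trSums S H) : c * y ∈ trSums S H :=
  map_mem_of_mem_trSums (AddMonoidHom.mulLeft c) (fun hL x hx => by
    rw [AddMonoidHom.coe_mulLeft, ← T.tr_res_mul]
    exact tr_mem_trSums _ (hS.mul_mem _ hx)) hy

theorem prod_trSums_mem (hS : IsMultiplicativeIdeal T S) {H : Subgroup G} {ι : Type*}
    {R : Finset ι} {f : ι → T.obj H} {i : ι} (hi : i ∈ R) (hf : f i ∈ trSums S H) :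
    ∏ j ∈ R, f j ∈ trSums S H := by
  classical
  rw [← Finset.prod_erase_mul R f hi]
  exact hS.mul_trSums_mem _ hf

theorem res_trSums_mem (hS : IsMultiplicativeIdeal T S) {K H : Subgroup G} (h : K ≤ H)
    {y : T.obj H} (hy : y ∈ trSums S H) : T.res h y ∈ trSums S K :=
  map_mem_of_mem_trSums (T.res h).toAddMonoidHom (fun {L} hL x hx => by
    obtain ⟨R, hR⟩ := TambaraIdeal.exists_isDoubleCosetReps K L (H : Set G)
    change T.res h (T.tr hL x) ∈ _
    rw [T.res_tr h hL R hR]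
    exact sum_mem fun γ _ => tr_mem_trSums _ (hS.conjRes_mem K γ hx)) hy

theorem conj_trSums_mem (hS : IsMultiplicativeIdeal T S) (g : G) {H H' : Subgroup G}
    (e : H' = MulAut.conj g • H) {y : T.obj H} (hy : y ∈ trSums S H) :
    T.conj g e y ∈ trSums S H' :=
  map_mem_of_mem_trSums (T.conj g e).toRingHom.toAddMonoidHom (fun {L} hL x hx => by
    have hL' : MulAut.conj g • L ≤ H' := by
      rw [e]; exact Subgroup.pointwise_smul_le_pointwise_smul_iff.2 hL
    change T.conj g e (T.tr hL x) ∈ _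
    rw [T.conj_tr g hL hL' rfl e]
    exact tr_mem_trSums _ (hS.conj_mem g rfl hx)) hy

/-- Tambara reciprocity writes the norm of a transfer as a sum of transfers of products of factors
in `S`. One factor in `S` is enough, but the product must not be empty. -/
theorem nm_tr_mem (hS : IsMultiplicativeIdeal T S) {J H K : Subgroup G} (hJH : J ≤ H)
    (hHK : H ≤ K) {x : T.obj J} (hx : x ∈ S J) : T.nm hHK (T.tr hJH x) ∈ trSums S K := by
  obtain ⟨R, hR⟩ := TambaraIdeal.exists_isOrbitReps K (cosetSections J H K)
  choose D hD using fun X : Set G =>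
    TambaraIdeal.exists_isDoubleCosetReps (translationStabilizer K X) J X
  rw [T.nm_tr hJH hHK R D hR (fun X _ => hD X) x]
  refine sum_mem fun X hX => ?_
  -- A section meets the coset `H` itself in a left coset of `J`.
  have hXne : X.Nonempty := by
    obtain ⟨δ, hδ⟩ := (hR.1 (Finset.mem_coe.2 hX)).2 1 K.one_mem
    have : δ ∈ X ∩ ((1 : G) • (H : Set G)) := by
      rw [hδ]; exact ⟨1, J.one_mem, by simp⟩
    exact ⟨δ, this.1⟩
  obtain ⟨γ, hγ⟩ := (hD X).nonempty hXne
  exact tr_mem_trSums _ (hS.prod_mem hγ (hS.nmConjRes_mem _ γ hx))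

/-- Norms are not additive, so two inductions are nested: on the target subgroup `K`, for all
sources at once, and on the number of transfers in the sum. Tambara reciprocity for `a + b` gives
transfers of products of norms to stabilizers, and one good factor in each product suffices. -/
theorem nm_trSums_mem (hS : IsMultiplicativeIdeal T S) {K H : Subgroup G} (h : H ≤ K)
    {y : T.obj H} (hy : y ∈ trSums S H) : T.nm h y ∈ trSums S K := by
  classical
  induction K using WellFoundedLT.induction generalizing H with
  | ind K ih =>
  refine AddSubmonoid.closure_induction (motive := fun z _ => T.nm h z ∈ trSums S K) ?_ ?_ ?_ hy
  · rintro _ ⟨J, hJ, x, hx, rfl⟩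
    exact hS.nm_tr_mem hJ h hx
  · exact mem_trSums (hS.nm_mem h (hS.zero_mem H))
  · intro a b ha hb hna hnb
    obtain ⟨R, hR⟩ := TambaraIdeal.exists_isOrbitReps K (cosetUnions H K)
    choose D hD using fun X : Set G =>
      TambaraIdeal.exists_isDoubleCosetReps (translationStabilizer K X) H (K : Set G)
    rw [T.nm_add h R D hR (fun X _ => hD X) a b]
    refine sum_mem fun X _ => ?_
    have hle : translationStabilizer K X ≤ K := inf_le_left
    refine tr_trSums_mem hle ?_
    obtain ⟨γ, hγ⟩ := (hD X).nonempty ⟨1, K.one_mem⟩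
    have key : ∀ z ∈ trSums S H, T.nm h z ∈ trSums S K →
        T.nmConjRes (translationStabilizer K X) γ z ∈ trSums S (translationStabilizer K X) := by
      intro z hz hnz
      -- If the stabilizer is all of `K`, the factor is a restriction of the norm of `a` or `b`,
      -- covered by the inner induction; if it is smaller, the outer induction applies.
      rcases hle.eq_or_lt with hK | hK
      · rw [TambaraFunctor.nmConjRes_of_eq h hK ((hD X).mem hγ)]
        exact hS.res_trSums_mem _ hnz
      · exact ih _ hK _ (hS.res_trSums_mem _ (hS.conj_trSums_mem γ rfl hz))
    refine hS.prod_trSums_mem (H := translationStabilizer K X) hγ ?_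
    split_ifs
    · exact key a ha hna
    · exact key b hb hnb

/-- The Tambara ideal consisting of the sums of transfers of elements of `S`. -/
def toTambaraIdeal (hS : IsMultiplicativeIdeal T S) : TambaraIdeal T where
  carrier H :=
    { trSums S H with
      smul_mem' := fun c _ hx => hS.mul_trSums_mem c hx }
  res_mem h _ hx := hS.res_trSums_mem h hx
  tr_mem h _ hx := tr_trSums_mem h hx
  nm_mem h _ hx := hS.nm_trSums_mem h hx
  conj_image := TambaraIdeal.conj_image_of_forall _ fun g _ _ e _ hx => hS.conj_trSums_mem g e hx

end IsMultiplicativeIdeal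

/-! ### Products of Tambara ideals -/

namespace TambaraIdeal

variable {S S' : ∀ H : Subgroup G, Set (T.obj H)}

/-- The Tambara ideal generated by a set of elements at each level. -/
def levelSpan (S : ∀ H : Subgroup G, Set (T.obj H)) : TambaraIdeal T :=
  span {p | p.2 ∈ S p.1}

theorem levelSpan_le {I : TambaraIdeal T} :
    levelSpan S ≤ I ↔ ∀ H, S H ⊆ I.carrier H := by
  rw [levelSpan, span_le]
  exact ⟨fun h H x hx => h ⟨H, x⟩ hx, fun h p hp => h p.1 hp⟩

theorem subset_levelSpan (H : Subgroup G) : S H ⊆ (levelSpan S).carrier H :=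
  levelSpan_le.1 le_rfl H

theorem levelSpan_carrier (I : TambaraIdeal T) :
    levelSpan (fun H => (I.carrier H : Set (T.obj H))) = I :=
  le_antisymm (levelSpan_le.2 fun _ => le_rfl) fun H =>
    subset_levelSpan (S := fun H => (I.carrier H : Set (T.obj H))) H

/-- Every Tambara ideal containing `S` contains the sums of transfers of its elements, and these
already form a Tambara ideal. -/
theorem levelSpan_eq_toTambaraIdeal (hS : IsMultiplicativeIdeal T S) :
    levelSpan S = hS.toTambaraIdeal := by
  apply le_antisymm
  · exact levelSpan_le.2 fun H _ hx => IsMultiplicativeIdeal.mem_trSums hx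
  · intro H x hx
    refine IsMultiplicativeIdeal.map_mem_of_mem_trSums (AddMonoidHom.id _)
      (A := ((levelSpan S).carrier H).toAddSubmonoid) ?_ hx
    exact fun h y hy => (levelSpan S).tr_mem h (subset_levelSpan _ hy)

/-- Frobenius reciprocity, the double coset formula and Frobenius reciprocity again write the
product as a sum of iterated transfers of products `res a * conjRes b`, which lie in `I`. -/
theorem tr_mul_tr_mem (hS : IsMultiplicativeIdeal T S) (hS' : IsMultiplicativeIdeal T S')
    {I : TambaraIdeal T} (hI : ∀ H, ∀ a ∈ S H, ∀ b ∈ S' H, a * b ∈ I.carrier H)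
    {K L H : Subgroup G} (hK : K ≤ H) (hL : L ≤ H) {a : T.obj K} {b : T.obj L} (ha : a ∈ S K)
    (hb : b ∈ S' L) : T.tr hK a * T.tr hL b ∈ I.carrier H := by
  rw [mul_comm, ← T.tr_res_mul]
  refine I.tr_mem _ ?_
  obtain ⟨R, hR⟩ := exists_isDoubleCosetReps K L (H : Set G)
  rw [T.res_tr hK hL R hR, Finset.sum_mul]
  refine Ideal.sum_mem _ fun γ _ => ?_
  rw [mul_comm, TambaraData.trConjRes, ← T.tr_res_mul]
  exact I.tr_mem _ (hI _ _ (hS.res_mem _ ha) _ (hS'.conjRes_mem K γ hb))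

/-- The product of the ideals generated by two multiplicative ideals lies in `I` as soon as
the products of the generators do. -/
theorem levelSpan_mul_levelSpan_le (hS : IsMultiplicativeIdeal T S)
    (hS' : IsMultiplicativeIdeal T S') {I : TambaraIdeal T} :
    levelSpan S * levelSpan S' ≤ I ↔ ∀ H, ∀ a ∈ S H, ∀ b ∈ S' H, a * b ∈ I.carrier H := by
  constructor
  · intro h H a ha b hb
    exact mul_le.1 h H (Ideal.mul_mem_mul (subset_levelSpan H ha) (subset_levelSpan H hb))
  · intro hI
    rw [levelSpan_eq_toTambaraIdeal hS, levelSpan_eq_toTambaraIdeal hS', mul_le]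
    intro H
    rw [Ideal.mul_le]
    intro x hx y hy
    refine IsMultiplicativeIdeal.map_mem_of_mem_trSums (AddMonoidHom.mulRight y)
      (A := (I.carrier H).toAddSubmonoid) (fun hK a ha => ?_) hx
    refine IsMultiplicativeIdeal.map_mem_of_mem_trSums (AddMonoidHom.mulLeft _)
      (A := (I.carrier H).toAddSubmonoid) (fun hL b hb => ?_) hy
    exact tr_mul_tr_mem hS hS' hI hK hL ha hb

end TambaraIdeal

/-- Restrictions, norms and conjugations are multiplicative, so bare products `a * b` suffice,
without sums. This lets triple products be compared in `TambaraIdeal.mul_assoc`. -/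
theorem IsMultiplicativeIdeal.mul {S S' : ∀ H : Subgroup G, Set (T.obj H)}
    (hS : IsMultiplicativeIdeal T S) (hS' : IsMultiplicativeIdeal T S') :
    IsMultiplicativeIdeal T fun H => S H * S' H where
  zero_mem H := ⟨0, hS.zero_mem H, 0, hS'.zero_mem H, mul_zero 0⟩
  mul_mem := by
    rintro H c _ ⟨a, ha, b, hb, rfl⟩
    exact ⟨c * a, hS.mul_mem c ha, b, hb, mul_assoc c a b⟩
  res_mem := by
    rintro K H h _ ⟨a, ha, b, hb, rfl⟩
    exact ⟨_, hS.res_mem h ha, _, hS'.res_mem h hb, (map_mul (T.res h) a b).symm⟩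
  nm_mem := by
    rintro K H h _ ⟨a, ha, b, hb, rfl⟩
    exact ⟨_, hS.nm_mem h ha, _, hS'.nm_mem h hb, (map_mul (T.nm h) a b).symm⟩
  conj_mem := by
    rintro g H H' e _ ⟨a, ha, b, hb, rfl⟩
    exact ⟨_, hS.conj_mem g e ha, _, hS'.conj_mem g e hb, (map_mul (T.conj g e) a b).symm⟩

namespace TambaraIdeal

theorem levelSpan_mul_levelSpan {S S' : ∀ H : Subgroup G, Set (T.obj H)}
    (hS : IsMultiplicativeIdeal T S) (hS' : IsMultiplicativeIdeal T S') :
    levelSpan S * levelSpan S' = levelSpan fun H => S H * S' H := by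
  apply le_antisymm
  · rw [levelSpan_mul_levelSpan_le hS hS']
    exact fun H a ha b hb => subset_levelSpan H (Set.mul_mem_mul ha hb)
  · rw [levelSpan_le]
    rintro H _ ⟨a, ha, b, hb, rfl⟩
    exact (levelSpan_mul_levelSpan_le hS hS').1 le_rfl H a ha b hb

theorem mul_eq_levelSpan (I J : TambaraIdeal T) :
    I * J = levelSpan fun H => (I.carrier H : Set (T.obj H)) * (J.carrier H : Set (T.obj H)) := by
  rw [← levelSpan_mul_levelSpan I.isMultiplicativeIdeal J.isMultiplicativeIdeal,
    levelSpan_carrier, levelSpan_carrier]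

protected theorem mul_comm (I J : TambaraIdeal T) : I * J = J * I := by
  simp only [mul_eq_levelSpan, mul_comm]

protected theorem mul_assoc (I J K : TambaraIdeal T) : I * J * K = I * (J * K) := by
  have hI := I.isMultiplicativeIdeal
  have hJ := J.isMultiplicativeIdeal
  have hK := K.isMultiplicativeIdeal
  rw [← levelSpan_carrier I, ← levelSpan_carrier J, ← levelSpan_carrier K,
    levelSpan_mul_levelSpan hI hJ, levelSpan_mul_levelSpan hJ hK,
    levelSpan_mul_levelSpan (hI.mul hJ) hK, levelSpan_mul_levelSpan hI (hJ.mul hK)]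
  simp only [mul_assoc]

theorem mem_top {H : Subgroup G} (x : T.obj H) : x ∈ (⊤ : TambaraIdeal T).carrier H :=
  mem_sInf.2 fun _ hI => hI.elim

protected theorem top_mul (I : TambaraIdeal T) : ⊤ * I = I := by
  refine le_antisymm (mul_le_right _ _) fun H x hx => le_mul _ _ H ?_
  rw [← one_mul x]
  exact Ideal.mul_mem_mul (mem_top 1) hx

/-- The levelwise union of the `J i` need not be closed under addition, but it is a multiplicative
ideal generating the join, so the inclusion is checked on elements of single `J i`. -/
theorem mul_iSup_le {ι : Type*} (I : TambaraIdeal T) (J : ι → TambaraIdeal T) :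
    I * ⨆ i, J i ≤ ⨆ i, I * J i := by
  -- An empty union would not contain zero, so this case is separate.
  rcases isEmpty_or_nonempty ι with hι | ⟨⟨i₀⟩⟩
  · rw [iSup_of_empty, iSup_of_empty]
    exact mul_le_right I ⊥
  have hS : IsMultiplicativeIdeal T fun H => ⋃ i, ((J i).carrier H : Set (T.obj H)) :=
    { zero_mem := fun H => Set.mem_iUnion.2 ⟨i₀, ((J i₀).carrier H).zero_mem⟩
      mul_mem := fun c _ hx => by
        obtain ⟨i, hi⟩ := Set.mem_iUnion.1 hx
        exact Set.mem_iUnion.2 ⟨i, Ideal.mul_mem_left _ c hi⟩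
      res_mem := fun h _ hx => by
        obtain ⟨i, hi⟩ := Set.mem_iUnion.1 hx
        exact Set.mem_iUnion.2 ⟨i, (J i).res_mem h hi⟩
      nm_mem := fun h _ hx => by
        obtain ⟨i, hi⟩ := Set.mem_iUnion.1 hx
        exact Set.mem_iUnion.2 ⟨i, (J i).nm_mem h hi⟩
      conj_mem := fun g _ _ e _ hx => by
        obtain ⟨i, hi⟩ := Set.mem_iUnion.1 hx
        exact Set.mem_iUnion.2 ⟨i, (J i).conj_mem g e hi⟩ }
  have hsup : ⨆ i, J i ≤ levelSpan fun H => ⋃ i, ((J i).carrier H : Set (T.obj H)) :=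
    iSup_le fun i H => (Set.subset_iUnion _ i).trans
      (subset_levelSpan (S := fun H => ⋃ i, ((J i).carrier H : Set (T.obj H))) H)
  refine (mul_mono (levelSpan_carrier I).ge hsup).trans
    ((levelSpan_mul_levelSpan_le I.isMultiplicativeIdeal hS).2 fun H a ha b hb => ?_)
  obtain ⟨i, hi⟩ := Set.mem_iUnion.1 hb
  exact le_iSup (fun i => I * J i) i H (le_mul _ _ H (Ideal.mul_mem_mul ha hi))

end TambaraIdeal

end MultiplicativeIdeals

/-! ### Finitely generated ideals and compactness -/

section FinitelyGenerated

variable {G : Type v} [Group G] [Finite G] {T : TambaraFunctor.{u} G}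

/-- The norms to level `G / K` of restrictions of conjugates of elements of `X`. -/
def normGenerators (X : Set (Σ H : Subgroup G, T.obj H)) (K : Subgroup G) : Set (T.obj K) :=
  ⋃ p ∈ X, ⋃ (γ : G) (L : Subgroup G) (hLK : L ≤ K) (hL : L ≤ MulAut.conj γ • p.1),
    {T.nm hLK (T.res hL (T.conj γ rfl p.2))}

/-- The multiples of the norms of restrictions of conjugates of elements of `X`. -/
def normHull (X : Set (Σ H : Subgroup G, T.obj H)) (K : Subgroup G) : Set (T.obj K) :=
  {y | ∃ c, ∃ b ∈ normGenerators X K, y = c * b}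

variable {X Y : Set (Σ H : Subgroup G, T.obj H)}

theorem mem_normGenerators {K : Subgroup G} {y : T.obj K} :
    y ∈ normGenerators X K ↔ ∃ p ∈ X, ∃ (γ : G) (L : Subgroup G) (hLK : L ≤ K)
      (hL : L ≤ MulAut.conj γ • p.1), y = T.nm hLK (T.res hL (T.conj γ rfl p.2)) := by
  simp only [normGenerators, Set.mem_iUnion, Set.mem_singleton_iff, exists_prop]

theorem finite_normGenerators (hX : X.Finite) (K : Subgroup G) : (normGenerators X K).Finite :=
  hX.biUnion fun _ _ => Set.finite_iUnion fun _ => Set.finite_iUnion fun _ =>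
    Set.finite_iUnion fun _ => Set.finite_iUnion fun _ => Set.finite_singleton _

theorem normGenerators_subset_normHull (K : Subgroup G) : normGenerators X K ⊆ normHull X K :=
  fun b hb => ⟨1, b, hb, (one_mul b).symm⟩

theorem mem_normGenerators_of_mem {p : Σ H : Subgroup G, T.obj H} (hp : p ∈ X) :
    p.2 ∈ normGenerators X p.1 := by
  have e : p.1 = MulAut.conj (1 : G) • p.1 := by simp
  refine mem_normGenerators.2 ⟨p, hp, 1, p.1, le_rfl, e.le, ?_⟩
  have := T.conj_res 1 le_rfl e.le e rfl p.2
  rw [T.nm_self, ← this, T.res_self, T.conj_self (one_mem p.1)]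

theorem normGenerators_subset {I : TambaraIdeal T} (hI : TambaraIdeal.span X ≤ I)
    (K : Subgroup G) : normGenerators X K ⊆ I.carrier K := by
  intro y hy
  obtain ⟨p, hp, γ, L, hLK, hL, rfl⟩ := mem_normGenerators.1 hy
  exact I.nm_mem _ (I.res_mem _ (I.conj_mem _ _ (TambaraIdeal.span_le.1 hI p hp)))

theorem levelSpan_normHull : TambaraIdeal.levelSpan (normHull X) = TambaraIdeal.span X := by
  apply le_antisymm
  · rw [TambaraIdeal.levelSpan_le]
    rintro K _ ⟨c, b, hb, rfl⟩
    exact Ideal.mul_mem_left _ c (normGenerators_subset le_rfl K hb)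
  · rw [TambaraIdeal.span_le]
    exact fun p hp => TambaraIdeal.subset_levelSpan _
      (normGenerators_subset_normHull _ (mem_normGenerators_of_mem hp))

theorem nmConjRes_mem_normGenerators {K : Subgroup G} {p : Σ H : Subgroup G, T.obj H} (hp : p ∈ X)
    {γ : G} (hK : K ≤ MulAut.conj γ • p.1) (L : Subgroup G) (δ : G) :
    T.nmConjRes L δ (T.res hK (T.conj γ rfl p.2)) ∈ normGenerators X L := by
  have h := Subgroup.le_conj_mul_smul (δ := δ) hK
  refine mem_normGenerators.2 ⟨p, hp, δ * γ, _, inf_le_left, inf_le_right.trans h, ?_⟩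
  rw [TambaraData.nmConjRes, TambaraData.conjRes, TambaraFunctor.conj_res_conj _ _ _ _ _ h,
    T.res_res]

/-- Norms compose and commute with conjugation, and the restriction of a norm is a product of norms
of the same shape. The hypothesis `h0` supplies zero at every level, even when there are no other
generators. -/
theorem isMultiplicativeIdeal_normHull (h0 : ⟨⊤, 0⟩ ∈ X) :
    IsMultiplicativeIdeal T (normHull X) where
  zero_mem K := by
    have h : K ≤ MulAut.conj (1 : G) • ⊤ := by simp
    refine normGenerators_subset_normHull K (mem_normGenerators.2 ⟨_, h0, 1, K, le_rfl, h, ?_⟩)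
    rw [T.nm_self, map_zero, map_zero]
  mul_mem := by
    rintro K c _ ⟨d, b, hb, rfl⟩
    exact ⟨c * d, b, hb, (mul_assoc c d b).symm⟩
  res_mem := by
    rintro L K h _ ⟨c, b, hb, rfl⟩
    obtain ⟨p, hp, γ, J, hJ, hJp, rfl⟩ := mem_normGenerators.1 hb
    obtain ⟨R, hR⟩ := TambaraIdeal.exists_isDoubleCosetReps L J (K : Set G)
    obtain ⟨δ, hδ⟩ := hR.nonempty ⟨1, K.one_mem⟩
    classical
    -- One factor is kept as the generator; the others are absorbed into the coefficient.
    rw [map_mul, T.res_nm h hJ R hR, ← Finset.prod_erase_mul R _ hδ, ← mul_assoc]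
    exact ⟨_, _, nmConjRes_mem_normGenerators hp hJp L δ, rfl⟩
  nm_mem := by
    rintro L K h _ ⟨c, b, hb, rfl⟩
    obtain ⟨p, hp, γ, J, hJ, hJp, rfl⟩ := mem_normGenerators.1 hb
    exact ⟨_, _, mem_normGenerators.2 ⟨p, hp, γ, J, hJ.trans h, hJp, rfl⟩, by
      rw [map_mul, T.nm_nm]⟩
  conj_mem := by
    rintro g K K' e _ ⟨c, b, hb, rfl⟩
    obtain ⟨p, hp, γ, J, hJ, hJp, rfl⟩ := mem_normGenerators.1 hb
    have hJ' : MulAut.conj g • J ≤ K' := by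
      rw [e]; exact Subgroup.pointwise_smul_le_pointwise_smul_iff.2 hJ
    have hJp' := Subgroup.le_conj_mul_smul (δ := g) hJp
    rw [map_mul, T.conj_nm g hJ hJ' rfl e, TambaraFunctor.conj_res_conj _ _ _ _ _ hJp']
    exact ⟨_, _, mem_normGenerators.2 ⟨p, hp, g * γ, _, hJ', hJp', rfl⟩, rfl⟩

namespace TambaraIdeal

theorem span_insert_zero : span (insert ⟨⊤, 0⟩ X) = span X := by
  apply le_antisymm
  · rw [span_le]
    rintro p (rfl | hp)
    · exact ((span X).carrier _).zero_mem
    · exact span_le.1 le_rfl p hp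
  · exact span_le.2 fun p hp => span_le.1 le_rfl p (Set.mem_insert_of_mem _ hp)

theorem span_mul_span (hX : ⟨⊤, 0⟩ ∈ X) (hY : ⟨⊤, 0⟩ ∈ Y) :
    span X * span Y = levelSpan fun H => normGenerators X H * normGenerators Y H := by
  apply le_antisymm
  · rw [← levelSpan_normHull, ← levelSpan_normHull, levelSpan_mul_levelSpan_le
      (isMultiplicativeIdeal_normHull hX) (isMultiplicativeIdeal_normHull hY)]
    rintro H _ ⟨c, a, ha, rfl⟩ _ ⟨d, b, hb, rfl⟩
    rw [mul_mul_mul_comm]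
    exact Ideal.mul_mem_left _ _ (subset_levelSpan H (Set.mul_mem_mul ha hb))
  · rw [levelSpan_le]
    rintro H _ ⟨a, ha, b, hb, rfl⟩
    exact le_mul _ _ H (Ideal.mul_mem_mul (normGenerators_subset le_rfl H ha)
      (normGenerators_subset le_rfl H hb))

theorem fg_levelSpan {S : ∀ H : Subgroup G, Set (T.obj H)} (hS : ∀ H, (S H).Finite) :
    (levelSpan S).FG := by
  refine ⟨_, ?_, rfl⟩
  have h : {p : Σ H : Subgroup G, T.obj H | p.2 ∈ S p.1} = ⋃ H, Sigma.mk H '' S H := by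
    ext ⟨H, x⟩
    simp only [Set.mem_ofPred_eq, Set.mem_iUnion, Set.mem_image]
    constructor
    · exact fun hx => ⟨H, x, hx, rfl⟩
    · rintro ⟨K, y, hy, h⟩
      cases h
      exact hy
  rw [h]
  exact Set.finite_iUnion fun H => (hS H).image _

/-- Adjoining zero changes neither ideal. The product is then generated by products of norm
generators, finitely many at each of the finitely many levels. -/
theorem FG.mul {I J : TambaraIdeal T} (hI : I.FG) (hJ : J.FG) : (I * J).FG := by
  obtain ⟨X, hX, rfl⟩ := hI
  obtain ⟨Y, hY, rfl⟩ := hJ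
  rw [← span_insert_zero (X := X), ← span_insert_zero (X := Y),
    span_mul_span (Set.mem_insert _ _) (Set.mem_insert _ _)]
  exact fg_levelSpan fun H => (finite_normGenerators (hX.insert _) H).mul
    (finite_normGenerators (hY.insert _) H)

theorem fg_principal {H : Subgroup G} (x : T.obj H) : (principal x).FG :=
  ⟨_, Set.finite_singleton _, rfl⟩

theorem span_union : span (X ∪ Y) = span X ⊔ span Y := by
  apply eq_of_forall_ge_iff
  intro I
  rw [sup_le_iff, span_le, span_le, span_le]
  exact Set.union_subset_iff (s := X) (t := Y) (u := {p | p.2 ∈ I.carrier p.1})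

theorem FG.sup {I J : TambaraIdeal T} (hI : I.FG) (hJ : J.FG) : (I ⊔ J).FG := by
  obtain ⟨X, hX, rfl⟩ := hI
  obtain ⟨Y, hY, rfl⟩ := hJ
  exact ⟨X ∪ Y, hX.union hY, span_union.symm⟩

theorem fg_bot : (⊥ : TambaraIdeal T).FG :=
  ⟨∅, Set.finite_empty, (le_bot_iff.1 (span_le.2 (by simp))).symm⟩

theorem fg_top : (⊤ : TambaraIdeal T).FG := by
  let X : Set (Σ H : Subgroup G, T.obj H) := {⟨⊤, 1⟩}
  have h : (⊤ : TambaraIdeal T) ≤ span X := by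
    intro H x _
    have h1 : (1 : T.obj ⊤) ∈ (span X).carrier ⊤ := span_le.1 le_rfl ⟨⊤, 1⟩ rfl
    have h2 := (span X).res_mem (le_top : H ≤ ⊤) h1
    rw [map_one] at h2
    rw [← mul_one x]
    exact Ideal.mul_mem_left _ x h2
  exact ⟨X, Set.finite_singleton _, (top_le_iff.1 h).symm⟩

theorem FG.power {I : TambaraIdeal T} (hI : I.FG) : ∀ n, (power I n).FG
  | 0 => fg_top
  | n + 1 => (hI.power n).mul hI

/-- A directed union of Tambara ideals is a Tambara ideal. -/
theorem mem_sSup_of_directedOn {F : Set (TambaraIdeal T)} (hne : F.Nonempty)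
    (hF : DirectedOn (· ≤ ·) F) {H : Subgroup G} {x : T.obj H} :
    x ∈ (sSup F).carrier H ↔ ∃ I ∈ F, x ∈ I.carrier H := by
  constructor
  · let U : TambaraIdeal T :=
      { carrier := fun H =>
          { carrier := {x | ∃ I ∈ F, x ∈ I.carrier H}
            zero_mem' := hne.imp fun I hI => ⟨hI, (I.carrier H).zero_mem⟩
            add_mem' := by
              rintro x y ⟨I, hI, hx⟩ ⟨J, hJ, hy⟩
              obtain ⟨K, hK, hIK, hJK⟩ := hF I hI J hJ
              exact ⟨K, hK, Ideal.add_mem _ (hIK H hx) (hJK H hy)⟩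
            smul_mem' := fun c x ⟨I, hI, hx⟩ => ⟨I, hI, Ideal.mul_mem_left _ c hx⟩ }
        res_mem := fun h _ ⟨I, hI, hx⟩ => ⟨I, hI, I.res_mem h hx⟩
        tr_mem := fun h _ ⟨I, hI, hx⟩ => ⟨I, hI, I.tr_mem h hx⟩
        nm_mem := fun h _ ⟨I, hI, hx⟩ => ⟨I, hI, I.nm_mem h hx⟩
        conj_image := conj_image_of_forall _
          fun g _ _ e _ ⟨I, hI, hx⟩ => ⟨I, hI, I.conj_mem g e hx⟩ }
    have hU : sSup F ≤ U := sSup_le fun I hI _ _ hx => ⟨I, hI, hx⟩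
    exact fun hx => hU H hx
  · rintro ⟨I, hI, hx⟩
    exact le_sSup hI H hx

theorem FG.exists_le_of_le_sSup {J : TambaraIdeal T} (hJ : J.FG) {F : Set (TambaraIdeal T)}
    (hne : F.Nonempty) (hF : DirectedOn (· ≤ ·) F) (h : J ≤ sSup F) : ∃ I ∈ F, J ≤ I := by
  obtain ⟨X, hX, rfl⟩ := hJ
  induction X, hX using Set.Finite.induction_on with
  | empty => exact hne.imp fun I hI => ⟨hI, span_le.2 (by simp)⟩
  | @insert p X _ _ ih =>
    rw [← Set.singleton_union, span_union, sup_le_iff] at h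
    obtain ⟨I, hI, hXI⟩ := ih h.2
    obtain ⟨I', hI', hpI'⟩ := (mem_sSup_of_directedOn hne hF).1 (span_le.1 h.1 p rfl)
    obtain ⟨K, hK, hIK, hIK'⟩ := hF I hI I' hI'
    refine ⟨K, hK, ?_⟩
    rw [← Set.singleton_union, span_union]
    exact sup_le (span_le.2 (by rintro _ rfl; exact hIK' _ hpI')) (hXI.trans hIK)

end TambaraIdeal

end FinitelyGenerated

/-! ### Radicals and powers -/

section Radical

variable {G : Type v} [Group G] [Finite G] {T : TambaraFunctor.{u} G}

namespace TambaraIdeal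

theorem power_one (I : TambaraIdeal T) : power I 1 = I := I.top_mul

theorem power_add (I : TambaraIdeal T) (m : ℕ) : ∀ n, power I (m + n) = power I m * power I n
  | 0 => by
    rw [TambaraIdeal.mul_comm]
    exact (TambaraIdeal.top_mul _).symm
  | n + 1 => by
    change power I (m + n) * I = power I m * (power I n * I)
    rw [power_add I m n, TambaraIdeal.mul_assoc]

theorem power_mul (I : TambaraIdeal T) (m : ℕ) : ∀ n, power I (m * n) = power (power I m) n
  | 0 => rfl
  | n + 1 => by
    rw [Nat.mul_succ, power_add, power_mul I m n]
    rfl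

theorem mem_radical {I : TambaraIdeal T} {H : Subgroup G} {x : T.obj H} :
    x ∈ I.radical.carrier H ↔ ∃ n : ℕ, 1 ≤ n ∧ power (principal x) n ≤ I := Iff.rfl

theorem le_radical_of_power_le {I J : TambaraIdeal T} {n : ℕ} (hn : 1 ≤ n) (h : power J n ≤ I) :
    J ≤ I.radical :=
  fun _ _ hx => ⟨n, hn, (power_mono (principal_le.2 hx) n).trans h⟩

theorem le_radical (I : TambaraIdeal T) : I ≤ I.radical :=
  le_radical_of_power_le le_rfl (power_one I).le

theorem radical_mono {I J : TambaraIdeal T} (h : I ≤ J) : I.radical ≤ J.radical :=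
  fun _ _ ⟨n, hn, hx⟩ => ⟨n, hn, hx.trans h⟩

/-- A finitely generated ideal contained in the radical of `I` has a power contained in `I`. -/
theorem FG.exists_power_le_of_le_radical {I J : TambaraIdeal T} (hJ : J.FG) (h : J ≤ I.radical) :
    ∃ n : ℕ, 1 ≤ n ∧ TambaraIdeal.power J n ≤ I := by
  obtain ⟨X, hX, rfl⟩ := hJ
  induction X, hX using Set.Finite.induction_on with
  | empty => exact ⟨1, le_rfl, by rw [power_one]; exact span_le.2 (by simp)⟩
  | @insert p X _ _ ih =>
    rw [← Set.singleton_union, span_union] at h ⊢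
    rw [sup_le_iff] at h
    obtain ⟨m, hm, hmI⟩ := mem_radical.1 (span_le.1 h.1 p rfl)
    obtain ⟨n, -, hnI⟩ := ih h.2
    exact ⟨m + n, by omega, (power_sup_le _ _ _ m n rfl).trans (sup_le hmI hnI)⟩

/-- If ⟨x⟩ⁿ lies in √I, it is finitely generated, being a power of a principal ideal, so some power
(⟨x⟩ⁿ)ᵐ = ⟨x⟩ⁿᵐ lies in I. -/
theorem radical_radical (I : TambaraIdeal T) : I.radical.radical = I.radical := by
  refine le_antisymm ?_ (le_radical _)
  rintro H x ⟨n, hn, hx⟩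
  obtain ⟨m, hm, h⟩ := ((fg_principal x).power n).exists_power_le_of_le_radical hx
  exact ⟨n * m, Nat.mul_pos hn hm, by rwa [power_mul]⟩

theorem radical_le_radical_iff {I J : TambaraIdeal T} :
    I.radical ≤ J.radical ↔ I ≤ J.radical :=
  ⟨(le_radical I).trans, fun h => (radical_mono h).trans (radical_radical J).le⟩

/-- From ⟨x⟩ᵐ ⊆ I and ⟨x⟩ⁿ ⊆ J follows ⟨x⟩ᵐ⁺ⁿ ⊆ IJ. Meets of radical ideals thereby become products,
which distribute over joins. -/
theorem radical_mul (I J : TambaraIdeal T) : (I * J).radical = I.radical ⊓ J.radical := by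
  apply le_antisymm
  · exact le_inf (radical_mono (mul_le_left I J)) (radical_mono (mul_le_right I J))
  · intro H x hx
    obtain ⟨m, hm, hmI⟩ := mem_radical.1 ((inf_le_left : I.radical ⊓ J.radical ≤ _) H hx)
    obtain ⟨n, -, hnJ⟩ := mem_radical.1 ((inf_le_right : I.radical ⊓ J.radical ≤ _) H hx)
    exact ⟨m + n, by omega, by rw [power_add]; exact mul_mono hmI hnJ⟩

theorem radical_inf_radical_iSup_le {ι : Type*} (I : TambaraIdeal T) (J : ι → TambaraIdeal T) :
    I.radical ⊓ (⨆ i, J i).radical ≤ (⨆ i, I ⊓ J i).radical := by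
  rw [← radical_mul]
  exact radical_mono ((mul_iSup_le I J).trans
    (iSup_mono fun i => le_inf (mul_le_left _ _) (mul_le_right _ _)))

end TambaraIdeal

open TambaraIdeal

/-! ### The coherent frame of radical ideals -/

namespace RadId

/-- The radical of a Tambara ideal, as a radical Tambara ideal. -/
def ofIdeal (I : TambaraIdeal T) : RadId T := ⟨I.radical, (radical_radical I).symm⟩

theorem ofIdeal_le_iff {I : TambaraIdeal T} {J : RadId T} : ofIdeal I ≤ J ↔ I ≤ J.1 := by
  change I.radical ≤ J.1 ↔ _
  rw [J.2, radical_le_radical_iff]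

theorem ofIdeal_val (I : RadId T) : ofIdeal I.1 = I := Subtype.ext I.2.symm

/-- Taking the radical is left adjoint to the inclusion of the radical Tambara ideals. -/
def radicalGI : GaloisInsertion (ofIdeal (T := T)) Subtype.val where
  choice I h := ⟨I, le_antisymm (le_radical I) h⟩
  gc _ _ := ofIdeal_le_iff
  le_l_u I := (ofIdeal_val I).ge
  choice_eq I h := Subtype.ext (le_antisymm (le_radical I) h)

instance : CompleteLattice (RadId T) := radicalGI.liftCompleteLattice

instance : Order.Frame (RadId T) :=
  .ofMinimalAxioms
    { inf_sSup_le_iSup_inf := fun a s => by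
        -- In the lifted lattice, meets are meets of the underlying ideals and joins are radicals of
        -- their joins, so `h` unfolds to the required inequality.
        have h : a.1 ⊓ (sSup (Subtype.val '' s)).radical ≤
            (⨆ b : s, a.1 ⊓ b.1.1).radical := by
          rw [sSup_image']
          exact (inf_le_inf_right _ (le_radical _)).trans (radical_inf_radical_iSup_le _ _)
        refine le_trans (b := ofIdeal (⨆ b : s, a.1 ⊓ b.1.1)) h (ofIdeal_le_iff.2 ?_)
        exact iSup_le fun b => le_iSup₂ (f := fun b (_ : b ∈ s) => a ⊓ b) b.1 b.2 }

/-- Below a directed join, a power of `J` lies in the union of the family. That power is finitely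
generated, so it lies in a single member, which is radical and so contains `J`. -/
theorem isCompactElement_ofIdeal {J : TambaraIdeal T} (hJ : J.FG) :
    IsCompactElement (ofIdeal J) := by
  intro s w hne hs hw hJw
  have hws : w ≤ ofIdeal (sSup (Subtype.val '' s)) :=
    hw.2 fun b hb => (le_sSup (Set.mem_image_of_mem _ hb)).trans (le_radical _)
  obtain ⟨n, hn, hJn⟩ := hJ.exists_power_le_of_le_radical
    ((le_radical J).trans (hJw.trans hws))
  have hdir : DirectedOn (· ≤ ·) (Subtype.val '' s : Set (TambaraIdeal T)) := by
    rintro _ ⟨a, ha, rfl⟩ _ ⟨b, hb, rfl⟩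
    obtain ⟨c, hc, hac, hbc⟩ := hs a ha b hb
    exact ⟨c.1, ⟨c, hc, rfl⟩, hac, hbc⟩
  obtain ⟨_, ⟨b, hb, rfl⟩, hJb⟩ := (hJ.power n).exists_le_of_le_sSup (hne.image _) hdir hJn
  exact ⟨b, hb, ofIdeal_le_iff.2 ((le_radical_of_power_le hn hJb).trans b.2.ge)⟩

/-- The radicals of the finitely generated Tambara ideals contained in `I`. -/
def fgBelow (I : RadId T) : Set (RadId T) :=
  {b | ∃ J : TambaraIdeal T, J.FG ∧ J ≤ I.1 ∧ b = ofIdeal J}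

theorem isLUB_fgBelow (I : RadId T) : IsLUB (fgBelow I) I := by
  constructor
  · rintro _ ⟨J, -, hJ, rfl⟩
    exact ofIdeal_le_iff.2 hJ
  · intro K hK H x hx
    have h : ofIdeal (principal x) ≤ K := hK ⟨_, fg_principal x, principal_le.2 hx, rfl⟩
    exact principal_le.1 (ofIdeal_le_iff.1 h)

/-- The family `fgBelow I` is directed, since joins of finitely generated ideals are finitely
generated, and has join `I`; compactness puts `I` below one member. -/
theorem exists_fg_of_isCompactElement {I : RadId T} (hI : IsCompactElement I) :
    ∃ J : TambaraIdeal T, J.FG ∧ I = ofIdeal J := by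
  have hdir : DirectedOn (· ≤ ·) (fgBelow I) := by
    rintro _ ⟨J, hJ, hJI, rfl⟩ _ ⟨J', hJ', hJI', rfl⟩
    exact ⟨_, ⟨J ⊔ J', hJ.sup hJ', sup_le hJI hJI', rfl⟩, radical_mono le_sup_left,
      radical_mono le_sup_right⟩
  obtain ⟨_, ⟨J, hJ, hJI, rfl⟩, h⟩ :=
    hI (fgBelow I) I ⟨_, ⊥, fg_bot, bot_le, rfl⟩ hdir (isLUB_fgBelow I) le_rfl
  exact ⟨J, hJ, le_antisymm h (ofIdeal_le_iff.2 hJI)⟩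

theorem isCoherentFrame : IsCoherentFrame (RadId T) where
  eq_sSup_compact I :=
    ⟨fgBelow I, by rintro _ ⟨J, hJ, -, rfl⟩; exact isCompactElement_ofIdeal hJ,
      (isLUB_fgBelow I).sSup_eq.symm⟩
  compact_inf I J hI hJ := by
    obtain ⟨I, hfgI, rfl⟩ := exists_fg_of_isCompactElement hI
    obtain ⟨J, hfgJ, rfl⟩ := exists_fg_of_isCompactElement hJ
    -- The meet is the radical of the product, and products preserve finite generation; `I ⊓ J`
    -- itself need not be finitely generated.
    have h : ofIdeal I ⊓ ofIdeal J = ofIdeal (I * J) := Subtype.ext (radical_mul I J).symm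
    rw [h]
    exact isCompactElement_ofIdeal (hfgI.mul hfgJ)
  compact_top := by
    have h : (⊤ : RadId T).1 ≤ (ofIdeal ⊤ : RadId T).1 := le_top.trans (le_radical ⊤)
    rw [← top_le_iff.1 (show (⊤ : RadId T) ≤ ofIdeal ⊤ from h)]
    exact isCompactElement_ofIdeal fg_top

end RadId

end Radical

theorem mainTheorem4 {G : Type v} [Group G] [Finite G] (T : TambaraFunctor.{u} G) :
    (∃ F : Order.Frame (RadId T),
      (∀ I J : RadId T, F.le I J ↔ I.1 ≤ J.1) ∧ @IsCoherentFrame (RadId T) F) ∧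
    {I : TambaraIdeal T | ∃ h : I = I.radical, IsCompactElement (⟨I, h⟩ : RadId T)} = RadFg T := by
  refine ⟨⟨inferInstance, fun _ _ => Iff.rfl, RadId.isCoherentFrame⟩, ?_⟩
  ext I
  constructor
  · rintro ⟨h, hI⟩
    obtain ⟨J, hJ, hIJ⟩ := RadId.exists_fg_of_isCompactElement hI
    exact ⟨J, hJ, congrArg Subtype.val hIJ⟩
  · rintro ⟨J, hJ, rfl⟩
    exact ⟨_, RadId.isCompactElement_ofIdeal hJ⟩
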